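/- For a group $G$ let $G_1=G$ and $G_{c+1}=\langle [x,y] : x\in G_c,\ y\in G\rangle$ be the terms of its lower central series, and let $\widehat{G}_{\rm nil}$ be its pro-nilpotent completion, i.e. the inverse limit of the quotients $G/K$ over all normal subgroups $K$ with $G/K$ nilpotent. Two residually nilpotent groups $G,H$ have the same nilpotent genus if $G/G_c\cong H/H_c$ for all $c\ge 1$. **Proposition 3.1.** Let $1\to N\overset{u}{\to}\Gamma\overset{p}{\to} Q\to 1$ be a short exact sequence of groups, and for $c\geq 1$ let $u_c:N/N_c\to\Gamma/\Gamma_c$ be the homomorphism induced by $u$. Suppose that $N$ is finitely generated, that $Q$ has no non-trivial finite quotients, and that $H_2(Q,\mathbb Z)=0$. Suppose also that $\Gamma$ is finitely generated or, alternatively, that $Q$ is perfect. Then $u_c$ is an isomorphism for all $c\ge 1$, and the induced map $\widehat u_{\rm nil}:\widehat N_{\rm nil}\to\widehat\Gamma_{\rm nil}$ is an isomorphism. If moreover $\Gamma$ is residually nilpotent, then $N$ and $\Gamma$ have the same nilpotent genus (in particular $N$ is residually nilpotent). -/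

import Mathlib

universe u

/-- The `c`-th term `G_c` of the lower central series in the convention `G_1 = G`,
`G_{c+1} = ⟨[x, y] : x ∈ G_c, y ∈ G⟩`.  (Mathlib's series starts at index `0`; only `c ≥ 1` is
meaningful here.) -/
def lcsTerm (G : Type*) [Group G] (c : ℕ) : Subgroup G :=
  (⊤ : Subgroup G).lowerCentralSeries (c - 1)

instance lcsTerm_normal (G : Type*) [Group G] (c : ℕ) : (lcsTerm G c).Normal := by
  unfold lcsTerm; infer_instance

theorem lcsTerm_one (G : Type*) [Group G] : lcsTerm G 1 = ⊤ := rfl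

theorem lcsTerm_succ (G : Type*) [Group G] (c : ℕ) (hc : 1 ≤ c) :
    lcsTerm G (c + 1) =
      Subgroup.closure {z | ∃ x ∈ lcsTerm G c, ∃ y : G, x * y * x⁻¹ * y⁻¹ = z} := by
  obtain ⟨n, rfl⟩ : ∃ n, c = n + 1 := ⟨c - 1, by omega⟩
  ext z
  change z ∈ (⊤ : Subgroup G).lowerCentralSeries (n + 1) ↔ _
  rw [Subgroup.mem_lowerCentralSeries_succ_iff]
  simp [lcsTerm, commutatorElement_def]

theorem lcsTerm_le_comap {G H : Type*} [Group G] [Group H] (f : G →* H) (c : ℕ) :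
    lcsTerm G c ≤ (lcsTerm H c).comap f := by
  rw [← Subgroup.map_le_iff_le_comap]
  unfold lcsTerm
  induction c - 1 with
  | zero => simp
  | succ n ih =>
    rw [Subgroup.lowerCentralSeries_succ, Subgroup.lowerCentralSeries_succ,
      Subgroup.map_commutator]
    exact Subgroup.commutator_mono ih le_top

/-- The homomorphism `f_c : G/G_c → H/H_c` induced by `f : G → H`. -/
def lcsQuotientMap {G H : Type*} [Group G] [Group H] (f : G →* H) (c : ℕ) :
    G ⧸ lcsTerm G c →* H ⧸ lcsTerm H c :=
  QuotientGroup.map (lcsTerm G c) (lcsTerm H c) f (lcsTerm_le_comap f c)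

/-- The index set of the nilpotent quotients of `G`: normal subgroups `K` with `G/K` nilpotent. -/
structure NilpotentQuotientKernel (G : Type*) [Group G] where
  toSubgroup : Subgroup G
  normal : toSubgroup.Normal
  nilpotent : Group.IsNilpotent (G ⧸ toSubgroup)

instance NilpotentQuotientKernel.instNormal {G : Type*} [Group G]
    (K : NilpotentQuotientKernel G) : K.toSubgroup.Normal := K.normal

/-- If `H/K` is nilpotent, then so is `G/f⁻¹(K)`, which embeds in it. -/
def NilpotentQuotientKernel.comap {G H : Type*} [Group G] [Group H] (f : G →* H)
    (K : NilpotentQuotientKernel H) : NilpotentQuotientKernel G where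
  toSubgroup := K.toSubgroup.comap f
  normal := inferInstance
  nilpotent := by
    have := K.nilpotent
    refine Subgroup.isNilpotent_of_ker_le_center
      (QuotientGroup.map (K.toSubgroup.comap f) K.toSubgroup f le_rfl) ?_
    rw [QuotientGroup.ker_map, QuotientGroup.map_mk'_self]
    exact bot_le

/-- The pro-nilpotent completion of `G`: the inverse limit of the nilpotent quotients `G/K`, that
is, the compatible families in the product of all of them. -/
def ProNilpotentCompletion (G : Type*) [Group G] :
    Subgroup (∀ K : NilpotentQuotientKernel G, G ⧸ K.toSubgroup) where
  carrier := {x | ∀ (K L : NilpotentQuotientKernel G) (h : K.toSubgroup ≤ L.toSubgroup),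
    QuotientGroup.map K.toSubgroup L.toSubgroup (MonoidHom.id G)
      (h.trans (Subgroup.comap_id _).ge) (x K) = x L}
  mul_mem' := fun hx hy K L h => by simp [hx K L h, hy K L h]
  one_mem' := fun K L h => by simp
  inv_mem' := fun hx K L h => by simp [hx K L h]

/-- The homomorphism of pro-nilpotent completions induced by `f : G → H`.  Its `K`-coordinate is
the `f⁻¹(K)`-coordinate followed by the map `G/f⁻¹(K) → H/K` induced by `f`. -/
def proNilpotentMap {G H : Type*} [Group G] [Group H] (f : G →* H) :
    ProNilpotentCompletion G →* ProNilpotentCompletion H where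
  toFun x := ⟨fun K => QuotientGroup.map (K.comap f).toSubgroup K.toSubgroup f le_rfl
      (x.1 (K.comap f)), fun K L h => by
    have hx := x.2 (K.comap f) (L.comap f) (Subgroup.comap_mono h)
    dsimp only
    rw [← hx]
    obtain ⟨g, hg⟩ := QuotientGroup.mk_surjective (x.1 (K.comap f))
    rw [← hg]
    rfl⟩
  map_one' := by ext K; simp
  map_mul' x y := by ext K; simp

/-- `G` is residually nilpotent: every non-trivial element survives in some nilpotent group. -/
def IsResiduallyNilpotent (G : Type u) [Group G] : Prop :=
  ∀ g : G, g ≠ 1 → ∃ (P : Type u) (_ : Group P) (φ : G →* P), Group.IsNilpotent P ∧ φ g ≠ 1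

/-- Two residually nilpotent groups have the same nilpotent genus if they have the same lower
central series quotients. -/
structure SameNilpotentGenus (G H : Type*) [Group G] [Group H] : Prop where
  left : IsResiduallyNilpotent G
  right : IsResiduallyNilpotent H
  quotients : ∀ c : ℕ, 1 ≤ c → Nonempty ((G ⧸ lcsTerm G c) ≃* (H ⧸ lcsTerm H c))

/-- Every finite quotient of `G` is trivial. -/
def HasNoNontrivialFiniteQuotient (G : Type*) [Group G] : Prop :=
  ∀ K : Subgroup G, K.Normal → Finite (G ⧸ K) → Subsingleton (G ⧸ K)

/-- The second homology `H_2(G, ℤ)` with trivial coefficients.  (`ULift` only moves `ℤ` to the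
universe of `G`, as Mathlib's group homology requires.) -/
noncomputable abbrev integralH2 (G : Type u) [Group G] : ModuleCat (ULift.{u} ℤ) :=
  groupHomology (Rep.trivial (ULift.{u} ℤ) G (ULift.{u} ℤ)) 2

/-!
The quotient `Q` is perfect: if `Γ` is finitely generated, then so is the abelianization of `Q`, and
a finitely generated abelian group without non-trivial finite quotients is trivial.

The first point is that `Γ` acts trivially on the abelianization of `N`, that is,
`[N, Γ] = [N, N]`.  Modulo `m`-th powers this abelianization is finite, so the action on it factors
through a finite quotient of `Q` and is trivial; and in a finitely generated abelian group only the
neutral element is an `m`-th power for every `m`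
(`Subgroup.commutator_top_le_commutator_self`).  The three subgroups lemma then gives
`[N_i, Γ_j] ≤ N_{i+j}` (`Subgroup.commutator_lowerCentralSeries_le`).

Since `Q` is perfect, `Γ = N Γ_c`, so `u_c` is onto.  For injectivity, divide by `N_c` and assume
`N_c = 1`.  Then `T = Γ_{c+1}` commutes with `N`, and `Γ = N T` implies that `T` is perfect, so that
`T → Q` is a perfect central extension.  A perfect group with vanishing `H₂` has no non-trivial such
extension (`injective_of_superperfect`): a 2-cocycle is a linear function on 2-chains which vanishes
on boundaries, hence on cycles, hence factors through the differential `C₂ → C₁`, which is onto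
because `Q` is perfect; so the cocycle is a coboundary and the extension splits.  Therefore
`N ∩ T = 1`, and `N ∩ Γ_c = 1` follows because `Γ_c ≤ N_c T_c = T_c`
(`Subgroup.disjoint_ker_lowerCentralSeries`).

Finally, the quotients by the lower central series are cofinal among all nilpotent quotients, so the
maps `u_c` determine the map of pro-nilpotent completions (`bijective_proNilpotentMap`), and `N`
embeds in `Γ`, hence inherits residual nilpotence.
-/

/-! ### Central extensions of superperfect groups -/

theorem MonoidHom.eq_one_of_isPerfect {G A : Type*} [Group G] [CommGroup A] (hG : Group.IsPerfect G)
    (f : G →* A) (g : G) : f g = 1 :=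
  Abelianization.commutator_subset_ker f hG.mem_commutator

section Superperfect

open groupHomology Finsupp

variable {Q : Type u} [Group Q]

/-- If `H₂(Q, ℤ) = 0`, every inhomogeneous 2-cycle is a boundary. -/
theorem mem_range_d₃₂_of_subsingleton_integralH2 (hH2 : Subsingleton (integralH2 Q))
    (x : Q × Q →₀ ULift.{u} ℤ)
    (hx : d₂₁ (Rep.trivial (ULift.{u} ℤ) Q (ULift.{u} ℤ)) x = 0) :
    ∃ y, d₃₂ (Rep.trivial (ULift.{u} ℤ) Q (ULift.{u} ℤ)) y = x := by
  have h := (H2π_eq_zero_iff (A := Rep.trivial (ULift.{u} ℤ) Q (ULift.{u} ℤ)) ⟨x, hx⟩).1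
    (Subsingleton.elim _ _)
  exact h

/-- The cokernel of `C₂ → C₁` is generated by the image of `Q` under a homomorphism to a
commutative group, so it vanishes for perfect `Q`. -/
theorem d₂₁_surjective_of_isPerfect (hQ : Group.IsPerfect Q) :
    Function.Surjective (d₂₁ (Rep.trivial (ULift.{u} ℤ) Q (ULift.{u} ℤ))) := by
  set d : (Q × Q →₀ ULift.{u} ℤ) →ₗ[ULift.{u} ℤ] (Q →₀ ULift.{u} ℤ) :=
    (d₂₁ (Rep.trivial (ULift.{u} ℤ) Q (ULift.{u} ℤ))).hom
  change Function.Surjective d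
  have hds (a b : Q) : d (single (a, b) 1) = single b 1 - single (a * b) 1 + single a 1 :=
    d₂₁_single (A := Rep.trivial (ULift.{u} ℤ) Q (ULift.{u} ℤ)) (a, b) (1 : ULift.{u} ℤ)
  let q : Q →* Multiplicative ((Q →₀ ULift.{u} ℤ) ⧸ LinearMap.range d) :=
    MonoidHom.mk' (fun a => .ofAdd ((LinearMap.range d).mkQ (single a 1))) fun a b => by
      rw [← ofAdd_add, ← map_add]
      refine congrArg _ ((Submodule.Quotient.eq' _).2 ⟨single (a, b) 1, ?_⟩)
      rw [hds]
      abel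
  rw [← LinearMap.range_eq_top, eq_top_iff]
  rintro x -
  induction x using Finsupp.induction_linear with
  | zero => exact zero_mem _
  | add x y hx hy => exact add_mem hx hy
  | single a n =>
    have h : single a (1 : ULift.{u} ℤ) ∈ LinearMap.range d := by
      simpa [q] using congrArg Multiplicative.toAdd (q.eq_one_of_isPerfect hQ a)
    simpa using Submodule.smul_mem _ n h

/-- Every 2-cocycle of a superperfect group `Q`, for the trivial action on `A`, is a coboundary. -/
theorem exists_coboundary_of_superperfect (hQ : Group.IsPerfect Q)
    (hH2 : Subsingleton (integralH2 Q)) {A : Type*} [CommGroup A] (f : Q → Q → A)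
    (hf : ∀ a b c, f b c * f a (b * c) = f a b * f (a * b) c) :
    ∃ g : Q → A, ∀ a b, f a b * g (a * b) = g a * g b := by
  set d : (Q × Q →₀ ULift.{u} ℤ) →ₗ[ULift.{u} ℤ] (Q →₀ ULift.{u} ℤ) :=
    (d₂₁ (Rep.trivial (ULift.{u} ℤ) Q (ULift.{u} ℤ))).hom
  have hds (a b : Q) : d (single (a, b) 1) = single b 1 - single (a * b) 1 + single a 1 :=
    d₂₁_single (A := Rep.trivial (ULift.{u} ℤ) Q (ULift.{u} ℤ)) (a, b) (1 : ULift.{u} ℤ)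
  let F : (Q × Q →₀ ULift.{u} ℤ) →ₗ[ULift.{u} ℤ] Additive A :=
    Finsupp.linearCombination _ fun x => .ofMul (f x.1 x.2)
  have hF : LinearMap.ker d ≤ LinearMap.ker F := by
    intro x hx
    obtain ⟨y, rfl⟩ := mem_range_d₃₂_of_subsingleton_integralH2 hH2 x hx
    -- The cocycle identity says that `F` vanishes on the boundaries of the basis elements.
    suffices h : F ∘ₗ (d₃₂ (Rep.trivial (ULift.{u} ℤ) Q (ULift.{u} ℤ))).hom = 0 from
      LinearMap.congr_fun h y
    refine Finsupp.lhom_ext fun ⟨a, b, c⟩ n => ?_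
    have h := d₃₂_single (A := Rep.trivial (ULift.{u} ℤ) Q (ULift.{u} ℤ)) (a, b, c) n
    refine (congrArg F h).trans ?_
    have e : Additive.ofMul (f b c) - Additive.ofMul (f (a * b) c) + Additive.ofMul (f a (b * c))
        - Additive.ofMul (f a b) = 0 := by
      have := congrArg Additive.ofMul (hf a b c)
      simp only [ofMul_mul] at this
      rw [sub_eq_zero, sub_add_eq_add_sub, this]
      abel
    simp only [F, map_sub, map_add]
    simpa [smul_sub, smul_add] using congrArg (n • ·) e
  -- As `F` vanishes on cycles, it factors through the surjection `d`.
  obtain ⟨g, hg⟩ : ∃ g : (Q →₀ ULift.{u} ℤ) →ₗ[ULift.{u} ℤ] Additive A, g ∘ₗ d = F := by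
    refine ⟨(LinearMap.ker d).liftQ F hF ∘ₗ
      (d.quotKerEquivOfSurjective (d₂₁_surjective_of_isPerfect hQ)).symm.toLinearMap, ?_⟩
    refine LinearMap.ext fun x => ?_
    simp only [LinearMap.comp_apply, LinearEquiv.coe_coe,
      LinearMap.quotKerEquivOfSurjective_symm_apply]
    exact Submodule.liftQ_apply _ _ _
  refine ⟨fun a => (g (single a 1)).toMul, fun a b => ?_⟩
  have h := LinearMap.congr_fun hg (single (a, b) 1)
  simp only [LinearMap.comp_apply, hds, map_add, map_sub, F, linearCombination_single, one_smul] at h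
  apply Additive.ofMul.injective
  simp only [ofMul_mul, ofMul_toMul, ← h]
  abel

/-- A superperfect group has no non-trivial perfect central extension. -/
theorem injective_of_superperfect (hQ : Group.IsPerfect Q)
    (hH2 : Subsingleton (integralH2 Q)) {T : Type*} [Group T] (hT : Group.IsPerfect T)
    (π : T →* Q) (hπ : Function.Surjective π) (hker : π.ker ≤ Subgroup.center T) :
    Function.Injective π := by
  let _ : CommGroup (Subgroup.center T) :=
    { (inferInstance : Group (Subgroup.center T)) with
      mul_comm := fun a b => Subtype.ext (Subgroup.mem_center_iff.1 b.2 a) }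
  obtain ⟨σ, hσ⟩ := hπ.hasRightInverse
  let f (a b : Q) : Subgroup.center T := ⟨σ a * σ b * (σ (a * b))⁻¹, hker (by simp [hσ _])⟩
  have hf (a b : Q) : σ a * σ b = f a b * σ (a * b) := by simp [f]
  have hc (z : Subgroup.center T) (t : T) : t * z = z * t := Subgroup.mem_center_iff.1 z.2 t
  obtain ⟨g, hg⟩ := exists_coboundary_of_superperfect hQ hH2 f fun a b c => by
    apply Subtype.ext
    apply mul_right_cancel (b := σ (a * b * c))
    calc (f b c : T) * f a (b * c) * σ (a * b * c)
        = f b c * (f a (b * c) * σ (a * (b * c))) := by rw [mul_assoc (f b c : T), mul_assoc a b c]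
      _ = f b c * σ a * σ (b * c) := by rw [← hf, mul_assoc (f b c : T)]
      _ = σ a * (f b c * σ (b * c)) := by rw [← hc, mul_assoc]
      _ = σ a * σ b * σ c := by rw [← hf, mul_assoc]
      _ = f a b * (f (a * b) c * σ (a * b * c)) := by rw [hf a b, mul_assoc, hf]
      _ = f a b * f (a * b) c * σ (a * b * c) := by rw [← mul_assoc]
  -- The section `σ`, corrected by the cochain `g`.  The values of `g` need not lie in the
  -- kernel of `π`, so `s` is a section only up to the image of the centre, which suffices below.
  let s : Q →* T := MonoidHom.mk' (fun a => (g a : T)⁻¹ * σ a) fun a b => by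
    have h : (f a b : T) * g (a * b) = g a * g b := congrArg Subtype.val (hg a b)
    calc (g (a * b) : T)⁻¹ * σ (a * b) = ((f a b : T) * g (a * b))⁻¹ * (σ a * σ b) := by
          rw [hf]; group
      _ = (g b : T)⁻¹ * ((g a : T)⁻¹ * σ a) * σ b := by rw [h]; group
      _ = (g a : T)⁻¹ * σ a * ((g b : T)⁻¹ * σ b) := by
          have := hc (g b)⁻¹ ((g a : T)⁻¹ * σ a)
          rw [Subgroup.coe_inv] at this
          rw [← this, mul_assoc]
  have hz (t : T) : t * (s (π t))⁻¹ ∈ Subgroup.center T := by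
    have h : t * (σ (π t))⁻¹ ∈ Subgroup.center T := hker (by simp [hσ _])
    simpa [s, mul_assoc] using mul_mem h (g (π t)).2
  -- `t ↦ t * (s (π t))⁻¹` is a homomorphism from a perfect group to a commutative one.
  let r : T →* Subgroup.center T := MonoidHom.mk' (fun t => ⟨t * (s (π t))⁻¹, hz t⟩) fun t t' => by
    refine Subtype.ext ?_
    have := hc ⟨_, hz t'⟩ (s (π t))⁻¹
    calc t * t' * (s (π (t * t')))⁻¹ = t * (t' * (s (π t'))⁻¹ * (s (π t))⁻¹) := by
          simp [mul_assoc]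
      _ = t * (s (π t))⁻¹ * (t' * (s (π t'))⁻¹) := by rw [← this]; simp only [mul_assoc]
  have hr (t : T) : t = s (π t) :=
    mul_inv_eq_one.1 (congrArg Subtype.val (r.eq_one_of_isPerfect hT t))
  intro t t' h
  rw [hr t, hr t', h]

end Superperfect

/-! ### Groups without finite quotients acting on finitely generated abelian groups -/

section FiniteQuotients

open scoped IsMulCommutative commutatorElement

/-- A finitely generated abelian group has no non-trivial element that is an `m`-th power for every
`m ≠ 0`. -/
theorem CommGroup.eq_one_of_forall_exists_pow_eq {A : Type*} [CommGroup A] [Group.FG A] {a : A}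
    (h : ∀ m : ℕ, m ≠ 0 → ∃ b : A, b ^ m = a) : a = 1 := by
  have hfin : Module.Finite ℤ (Additive A) := Module.Finite.iff_addGroup_fg.2 inferInstance
  -- Krull's intersection theorem for the ideal `(m)` of `ℤ`.
  have key (m : ℕ) (hm : m ≠ 0) : ∃ r : ℤ, (r * m) • Additive.ofMul a = Additive.ofMul a := by
    have hmem : Additive.ofMul a ∈
        (⨅ i : ℕ, Ideal.span {(m : ℤ)} ^ i • ⊤ : Submodule ℤ (Additive A)) := by
      refine Submodule.mem_iInf _ |>.2 fun i => ?_
      obtain ⟨b, rfl⟩ := h (m ^ i) (pow_ne_zero i hm)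
      have := Submodule.smul_mem_smul (Ideal.pow_mem_pow (Ideal.mem_span_singleton_self (m : ℤ)) i)
        (Submodule.mem_top (x := Additive.ofMul b) (R := ℤ))
      rwa [← Nat.cast_pow, natCast_zsmul] at this
    obtain ⟨⟨r, hr⟩, h⟩ := (Ideal.mem_iInf_smul_pow_eq_bot_iff _ _).1 hmem
    obtain ⟨r, rfl⟩ := Ideal.mem_span_singleton'.1 hr
    exact ⟨r, h⟩
  -- With `m = 2` this makes `a` torsion, and with `m` a multiple of its order it kills `a`.
  obtain ⟨r, hr⟩ := key 2 two_ne_zero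
  have hn : (r * 2 - 1).natAbs ≠ 0 := by omega
  obtain ⟨s, hs⟩ := key _ hn
  have h0 : ((r * 2 - 1).natAbs : ℤ) • Additive.ofMul a = 0 := by
    obtain ⟨k, hk⟩ : (r * 2 - 1) ∣ ((r * 2 - 1).natAbs : ℤ) := Int.dvd_natAbs_self
    rw [hk, mul_comm, mul_smul, sub_smul, one_smul]
    simp only [Nat.cast_ofNat] at hr
    rw [hr, sub_self, smul_zero]
  rw [mul_smul, h0, smul_zero] at hs
  exact Additive.ofMul.injective hs.symm

theorem HasNoNontrivialFiniteQuotient.isPerfect {Q : Type*} [Group Q] [Group.FG Q]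
    (hQ : HasNoNontrivialFiniteQuotient Q) : Group.IsPerfect Q := by
  refine Group.isPerfect_def.2 (eq_top_iff.2 fun q _ => ?_)
  rw [← Abelianization.ker_of, MonoidHom.mem_ker]
  have : Group.FG (Abelianization Q) :=
    Group.fg_of_surjective (f := Abelianization.of) QuotientGroup.mk_surjective
  refine CommGroup.eq_one_of_forall_exists_pow_eq fun m hm => ?_
  let L := (powMonoidHom (α := Abelianization Q) m).range
  have hL : L.FiniteIndex := Subgroup.finiteIndex_range_powMonoidHom_of_fg _ hm
  have hK : (L.comap Abelianization.of).FiniteIndex := ⟨by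
    rw [Subgroup.index_comap_of_surjective _ (QuotientGroup.mk_surjective)]
    exact hL.index_ne_zero⟩
  have := hQ (L.comap Abelianization.of) inferInstance inferInstance
  have h := QuotientGroup.subsingleton_iff.1 this
  exact (h ▸ Subgroup.mem_top q : q ∈ L.comap Abelianization.of)

/-- The form in which the absence of finite quotients of `Q` is used: no proper normal subgroup of
finite index contains the kernel of a surjection onto `Q`. -/
theorem HasNoNontrivialFiniteQuotient.eq_top_of_ker_le {G Q : Type*} [Group G] [Group Q]
    (hQ : HasNoNontrivialFiniteQuotient Q) (p : G →* Q) (hp : Function.Surjective p)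
    (K : Subgroup G) (hK : K.Normal) (hpK : p.ker ≤ K) (hfin : K.FiniteIndex) : K = ⊤ := by
  have : (K.map p).FiniteIndex := ⟨by
    rw [Subgroup.index_map_eq _ hp hpK]
    exact hfin.index_ne_zero⟩
  have h := QuotientGroup.subsingleton_iff.1 (hQ (K.map p) (hK.map p hp) inferInstance)
  rw [← Subgroup.comap_map_eq_self hpK, h, Subgroup.comap_top]

namespace Subgroup

variable {G : Type*} [Group G]

/-- The kernel of the conjugation action on `M` contains `M` and has finite index, because the
automorphism group of `M` is finite. -/
theorem le_center_of_finite_of_isMulCommutative (M : Subgroup G) [M.Normal] [Finite M]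
    [IsMulCommutative M]
    (hM : ∀ K : Subgroup G, K.Normal → M ≤ K → K.FiniteIndex → K = ⊤) : M ≤ center G := by
  let φ : G →* MulAut M := MulAut.conjNormal
  have : Finite (MulAut M) := Finite.of_injective (fun e => (e : M → M)) DFunLike.coe_injective
  have hφ : φ.ker = ⊤ := by
    refine hM _ inferInstance (fun x hx => ?_) inferInstance
    ext y
    have h : x * y = y * x := congrArg Subtype.val (mul_comm (⟨x, hx⟩ : M) y)
    simp [φ, h]
  intro x hx
  refine mem_center_iff.2 fun g => ?_
  have hg : g ∈ φ.ker := hφ ▸ mem_top g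
  have : g * x * g⁻¹ = x := congrArg Subtype.val (DFunLike.congr_fun hg (⟨x, hx⟩ : M))
  exact mul_inv_eq_iff_eq_mul.1 this

/-- Reduction to the finite case by dividing by the subgroup of `m`-th powers, for all `m ≠ 0`. -/
theorem le_center_of_fg_of_isMulCommutative (M : Subgroup G) [hn : M.Normal] [Group.FG M]
    [IsMulCommutative M]
    (hM : ∀ K : Subgroup G, K.Normal → M ≤ K → K.FiniteIndex → K = ⊤) : M ≤ center G := by
  rw [← commutator_top_right_eq_bot_iff_le_center, eq_bot_iff, commutator_le]
  intro x hx g _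
  have hxg : ⁅x, g⁆ ∈ M := by
    simpa [commutatorElement_def, mul_assoc] using
      mul_mem hx (hn.conj_mem _ (inv_mem hx) g)
  suffices h : (⟨⁅x, g⁆, hxg⟩ : M) = 1 from congrArg Subtype.val h
  refine CommGroup.eq_one_of_forall_exists_pow_eq fun m hm => ?_
  -- It is enough that `⁅x, g⁆` is trivial modulo the subgroup `L` of `m`-th powers of `M`.
  let L : Subgroup G := (powMonoidHom (α := M) m).range.map M.subtype
  have hL : L.Normal := by
    refine ⟨?_⟩
    rintro _ ⟨_, ⟨y, rfl⟩, rfl⟩ g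
    exact ⟨_, ⟨⟨g * y * g⁻¹, hn.conj_mem _ y.2 g⟩, rfl⟩, by simp⟩
  let φ : M →* G ⧸ L := (QuotientGroup.mk' L).comp M.subtype
  have hφr : φ.range = M.map (QuotientGroup.mk' L) := by
    rw [MonoidHom.range_comp, range_subtype]
  have hφ : Finite φ.range := by
    have := finiteIndex_range_powMonoidHom_of_fg M hm
    have : φ.ker.FiniteIndex := finiteIndex_of_le (H := (powMonoidHom (α := M) m).range) <| by
      rintro _ ⟨y, rfl⟩
      exact (QuotientGroup.eq_one_iff _).2 ⟨_, ⟨y, rfl⟩, rfl⟩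
    exact Finite.of_equiv _ (QuotientGroup.quotientKerEquivRange φ).toEquiv
  have hn' : φ.range.Normal := hφr ▸ hn.map _ (QuotientGroup.mk'_surjective L)
  have hc : IsMulCommutative φ.range := inferInstance
  have hle := le_center_of_finite_of_isMulCommutative φ.range fun K hK hMK hfin => by
    have := hM (K.comap (QuotientGroup.mk' L)) inferInstance
      (map_le_iff_le_comap.1 (hφr ▸ hMK)) ⟨by
        rw [index_comap_of_surjective _ (QuotientGroup.mk'_surjective L)]
        exact hfin.index_ne_zero⟩
    rw [← map_comap_eq_self_of_surjective (QuotientGroup.mk'_surjective L) K, this,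
      map_top_of_surjective _ (QuotientGroup.mk'_surjective L)]
  have h1 : ⁅QuotientGroup.mk' L x, QuotientGroup.mk' L g⁆ = 1 :=
    commutatorElement_eq_one_iff_mul_comm.2
      (mem_center_iff.1 (hle ⟨⟨x, hx⟩, rfl⟩) (QuotientGroup.mk' L g)).symm
  rw [← map_commutatorElement, QuotientGroup.mk'_apply, QuotientGroup.eq_one_iff] at h1
  obtain ⟨_, ⟨y, rfl⟩, hy⟩ := h1
  exact ⟨y, Subtype.ext hy⟩

/-- The conjugation action of `G` on the abelianization of `N` is trivial. -/
theorem commutator_top_le_commutator_self (N : Subgroup G) [hn : N.Normal] [Group.FG N]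
    (hN : ∀ K : Subgroup G, K.Normal → N ≤ K → K.FiniteIndex → K = ⊤) : ⁅N, ⊤⁆ ≤ ⁅N, N⁆ := by
  let π := QuotientGroup.mk' ⁅N, N⁆
  have hπ : Function.Surjective π := QuotientGroup.mk'_surjective _
  have : (N.map π).Normal := hn.map π hπ
  have : Group.FG (N.map π) := Group.fg_of_surjective (π.subgroupMap_surjective N)
  have : IsMulCommutative (N.map π) := by
    rw [← commutator_self_eq_bot_iff, ← map_commutator, map_eq_bot_iff, QuotientGroup.ker_mk']
  have h := le_center_of_fg_of_isMulCommutative (N.map π) fun K hK hNK hfin => by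
    have := hN (K.comap π) inferInstance (map_le_iff_le_comap.1 hNK) ⟨by
      rw [index_comap_of_surjective _ hπ]
      exact hfin.index_ne_zero⟩
    rw [← map_comap_eq_self_of_surjective hπ K, this, map_top_of_surjective _ hπ]
  rwa [← commutator_top_right_eq_bot_iff_le_center, ← map_top_of_surjective π hπ, ← map_commutator,
    map_eq_bot_iff, QuotientGroup.ker_mk'] at h

end Subgroup

end FiniteQuotients

/-! ### Lower central series of a group and of a normal subgroup -/

namespace Subgroup

variable {G : Type*} [Group G]

/-- The three subgroups lemma, modulo a normal subgroup. -/
theorem commutator_commutator_le_of_rotate {H₁ H₂ H₃ K : Subgroup G} [K.Normal]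
    (h₁ : ⁅⁅H₂, H₃⁆, H₁⁆ ≤ K) (h₂ : ⁅⁅H₃, H₁⁆, H₂⁆ ≤ K) : ⁅⁅H₁, H₂⁆, H₃⁆ ≤ K := by
  have key (H : Subgroup G) : H ≤ K ↔ H.map (QuotientGroup.mk' K) = ⊥ := by
    rw [map_eq_bot_iff, QuotientGroup.ker_mk']
  rw [key] at h₁ h₂ ⊢
  simp only [map_commutator] at h₁ h₂ ⊢
  exact commutator_commutator_eq_bot_of_rotate h₁ h₂

theorem commutator_lowerCentralSeries_top_le (N : Subgroup G) [N.Normal]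
    (hN : ⁅N, (⊤ : Subgroup G)⁆ ≤ ⁅N, N⁆) (i : ℕ) :
    ⁅N.lowerCentralSeries i, (⊤ : Subgroup G)⁆ ≤ N.lowerCentralSeries (i + 1) := by
  induction i with
  | zero => exact hN
  | succ i ih =>
    rw [lowerCentralSeries_succ N i]
    refine commutator_commutator_le_of_rotate ?_ ?_
    · refine (commutator_mono hN le_rfl).trans (commutator_commutator_le_of_rotate ?_ le_rfl)
      rw [commutator_comm N]
      exact le_rfl
    · rw [commutator_comm ⊤]
      exact commutator_mono ih le_rfl

theorem commutator_lowerCentralSeries_le (N : Subgroup G) [N.Normal]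
    (hN : ⁅N, (⊤ : Subgroup G)⁆ ≤ ⁅N, N⁆) (i j : ℕ) :
    ⁅N.lowerCentralSeries i, (⊤ : Subgroup G).lowerCentralSeries j⁆ ≤
      N.lowerCentralSeries (i + j + 1) := by
  induction j generalizing i with
  | zero => exact commutator_lowerCentralSeries_top_le N hN i
  | succ j ih =>
    rw [commutator_comm, lowerCentralSeries_succ]
    refine commutator_commutator_le_of_rotate ?_ ?_
    · rw [commutator_comm ⊤]
      refine (commutator_mono (commutator_lowerCentralSeries_top_le N hN i) le_rfl).trans ?_
      simpa only [Nat.add_right_comm, Nat.add_assoc] using ih (i + 1)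
    · refine (commutator_mono (ih i) le_rfl).trans ?_
      exact commutator_lowerCentralSeries_top_le N hN _

theorem sup_commutator_le {A B C K : Subgroup G} [K.Normal] (hA : ⁅A, C⁆ ≤ K) (hB : ⁅B, C⁆ ≤ K) :
    ⁅A ⊔ B, C⁆ ≤ K := by
  have key (H : Subgroup G) : ⁅H, C⁆ ≤ K ↔
      H ≤ (centralizer (C.map (QuotientGroup.mk' K) : Set (G ⧸ K))).comap (QuotientGroup.mk' K) := by
    rw [← map_le_iff_le_comap, ← commutator_eq_bot_iff_le_centralizer, ← map_commutator,
      map_eq_bot_iff, QuotientGroup.ker_mk']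
  rw [key] at hA hB ⊢
  exact sup_le hA hB

theorem lowerCentralSeries_sup_le {M T : Subgroup G} [M.Normal] [T.Normal] (h : ⁅M, T⁆ = ⊥)
    (n : ℕ) :
    (M ⊔ T).lowerCentralSeries n ≤ M.lowerCentralSeries n ⊔ T.lowerCentralSeries n := by
  induction n with
  | zero => exact le_rfl
  | succ n ih =>
    have h₁ : ⁅M.lowerCentralSeries n, T⁆ = ⊥ :=
      eq_bot_iff.2 ((commutator_mono (lowerCentralSeries_le_self M n) le_rfl).trans h.le)
    have h₂ : ⁅T.lowerCentralSeries n, M⁆ = ⊥ :=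
      eq_bot_iff.2 ((commutator_mono (lowerCentralSeries_le_self T n) le_rfl).trans
        ((commutator_comm T M).trans h).le)
    simp only [lowerCentralSeries_succ]
    refine (commutator_mono ih le_rfl).trans (sup_commutator_le ?_ ?_) <;> rw [commutator_comm] <;>
      refine sup_commutator_le ?_ ?_ <;> rw [commutator_comm]
    · exact le_sup_left
    · exact h₁.trans_le bot_le
    · exact h₂.trans_le bot_le
    · exact le_sup_right

theorem sup_lowerCentralSeries_eq_top {Q : Type*} [Group Q] (p : G →* Q)
    (hp : Function.Surjective p) (hQ : Group.IsPerfect Q) (n : ℕ) :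
    p.ker ⊔ (⊤ : Subgroup G).lowerCentralSeries n = ⊤ := by
  have h : ((⊤ : Subgroup G).lowerCentralSeries n).map p = ⊤ := by
    rw [map_lowerCentralSeries, map_top_of_surjective p hp]
    induction n with
    | zero => rfl
    | succ n ih => rw [lowerCentralSeries_succ, ih]; exact hQ.commutator_eq_top
  rw [sup_comm, ← comap_map_eq, h, comap_top]

/-- If the kernel of `p` is nilpotent and `G` acts trivially on its abelianization, then a late term
`T` of the lower central series of `G` is a perfect central extension of `Q`, so it meets the kernel
trivially. -/
theorem disjoint_ker_lowerCentralSeries {Q : Type u} [Group Q] (p : G →* Q)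
    (hp : Function.Surjective p) (hQ : Group.IsPerfect Q) (hH2 : Subsingleton (integralH2 Q))
    (hker : ⁅p.ker, (⊤ : Subgroup G)⁆ ≤ ⁅p.ker, p.ker⁆) {n : ℕ}
    (hn : p.ker.lowerCentralSeries n = ⊥) :
    Disjoint p.ker ((⊤ : Subgroup G).lowerCentralSeries n) := by
  set M := p.ker with hM
  -- Perfectness of `T` comes from `T ≤ T.lowerCentralSeries (n + 1)`; with `n` in place of `n + 1` that
  -- inclusion would say nothing for `n = 0`.
  set T := (⊤ : Subgroup G).lowerCentralSeries (n + 1)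
  have hn' : M.lowerCentralSeries (n + 1) = ⊥ :=
    eq_bot_iff.2 ((lowerCentralSeries_antitone M n.le_succ).trans hn.le)
  have hMT : ⁅M, T⁆ = ⊥ := by
    refine eq_bot_iff.2 ((commutator_lowerCentralSeries_le M hker 0 (n + 1)).trans
      ((lowerCentralSeries_antitone M ?_).trans hn'.le))
    omega
  have hsup : M ⊔ T = ⊤ := sup_lowerCentralSeries_eq_top p hp hQ _
  have hle (k : ℕ) (hk : M.lowerCentralSeries k = ⊥) :
      (⊤ : Subgroup G).lowerCentralSeries k ≤ T.lowerCentralSeries k := by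
    simpa [hsup, hk] using lowerCentralSeries_sup_le hMT k
  have hperf : Group.IsPerfect T := by
    refine isPerfect_iff.2 (le_antisymm (commutator_le_self T) ?_)
    refine (hle _ hn').trans ?_
    rw [lowerCentralSeries_succ]
    exact commutator_mono (lowerCentralSeries_le_self T n) le_rfl
  have hinj := injective_of_superperfect hQ hH2 hperf (p.comp T.subtype) ?_ ?_
  · rw [disjoint_def]
    intro x hx hxn
    have hxT : x ∈ T := (hle n hn).trans (lowerCentralSeries_le_self T n) hxn
    have : (⟨x, hxT⟩ : T) = 1 := hinj (by simpa using MonoidHom.mem_ker.1 hx)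
    exact congrArg Subtype.val this
  · rw [← MonoidHom.range_eq_top, MonoidHom.range_comp, range_subtype, ← map_top_of_surjective p hp,
      ← hsup, map_sup, hM, (map_eq_bot_iff _).2 le_rfl, bot_sup_eq]
  · intro t ht
    refine mem_center_iff.2 fun t' => Subtype.ext ?_
    exact (mem_centralizer_iff.1 (commutator_eq_bot_iff_le_centralizer.1 hMT ht) t' t'.2)

/-- Reduction to nilpotent kernel by dividing by the `n`-th term of its lower central series. -/
theorem ker_inf_lowerCentralSeries_le {Q : Type u} [Group Q] (p : G →* Q)
    (hp : Function.Surjective p) (hQ : Group.IsPerfect Q) (hH2 : Subsingleton (integralH2 Q))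
    (hker : ⁅p.ker, (⊤ : Subgroup G)⁆ ≤ ⁅p.ker, p.ker⁆) (n : ℕ) :
    p.ker ⊓ (⊤ : Subgroup G).lowerCentralSeries n ≤ p.ker.lowerCentralSeries n := by
  let L := p.ker.lowerCentralSeries n
  let π := QuotientGroup.mk' L
  have hπ : Function.Surjective π := QuotientGroup.mk'_surjective _
  let p' : G ⧸ L →* Q := QuotientGroup.lift L p (lowerCentralSeries_le_self p.ker n)
  have hp'π : p'.comp π = p := by ext; rfl
  have hker' : p'.ker = p.ker.map π := by
    rw [← map_comap_eq_self_of_surjective hπ p'.ker, MonoidHom.comap_ker, hp'π]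
  have h := disjoint_ker_lowerCentralSeries p' (QuotientGroup.lift_surjective_of_surjective _ _ hp _)
    hQ hH2 (n := n) ?_ ?_
  · rw [hker', ← map_top_of_surjective π hπ, ← map_lowerCentralSeries] at h
    rintro x ⟨hx, hxn⟩
    exact (QuotientGroup.eq_one_iff x).1
      (disjoint_def.1 h (mem_map_of_mem π hx) (mem_map_of_mem π hxn))
  · rw [hker', ← map_top_of_surjective π hπ, ← map_commutator, ← map_commutator]
    exact map_mono hker
  · rw [hker', ← map_lowerCentralSeries, map_eq_bot_iff, QuotientGroup.ker_mk']

end Subgroup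

/-! ### Pro-nilpotent completions -/

section ProNilpotent

variable {G H : Type*} [Group G] [Group H]

theorem isNilpotent_quotient_of_lcsTerm_le {K : Subgroup G} [K.Normal] {c : ℕ}
    (h : lcsTerm G c ≤ K) : Group.IsNilpotent (G ⧸ K) := by
  refine Subgroup.nilpotent_iff_lowerCentralSeries.2 ⟨c - 1, ?_⟩
  rwa [← Subgroup.map_top_of_surjective _ (QuotientGroup.mk'_surjective K),
    ← Subgroup.map_lowerCentralSeries, Subgroup.map_eq_bot_iff, QuotientGroup.ker_mk']

theorem exists_lcsTerm_le_ker {P : Type*} [Group P] [hP : Group.IsNilpotent P] (f : G →* P) :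
    ∃ c, 1 ≤ c ∧ lcsTerm G c ≤ f.ker := by
  obtain ⟨n, hn⟩ := Subgroup.nilpotent_iff_lowerCentralSeries.1 hP
  refine ⟨n + 1, by omega, (lcsTerm_le_comap f (n + 1)).trans ?_⟩
  rw [← MonoidHom.comap_bot]
  exact Subgroup.comap_mono hn.le

theorem lcsTerm_antitone (G : Type*) [Group G] : Antitone (lcsTerm G) := fun _ _ h =>
  Subgroup.lowerCentralSeries_antitone _ (Nat.sub_le_sub_right h 1)

theorem NilpotentQuotientKernel.exists_lcsTerm_le (K : NilpotentQuotientKernel G) :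
    ∃ c, 1 ≤ c ∧ lcsTerm G c ≤ K.toSubgroup := by
  have := K.nilpotent
  simpa only [QuotientGroup.ker_mk'] using exists_lcsTerm_le_ker (QuotientGroup.mk' K.toSubgroup)

/-- The member `G_c` of the index set of the pro-nilpotent completion. -/
def NilpotentQuotientKernel.lcs (G : Type*) [Group G] (c : ℕ) : NilpotentQuotientKernel G where
  toSubgroup := lcsTerm G c
  normal := inferInstance
  nilpotent := isNilpotent_quotient_of_lcsTerm_le le_rfl

theorem proNilpotentMap_apply (f : G →* H) (x : ProNilpotentCompletion G)
    (K : NilpotentQuotientKernel H) :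
    (proNilpotentMap f x).1 K =
      QuotientGroup.map (K.comap f).toSubgroup K.toSubgroup f le_rfl (x.1 (K.comap f)) :=
  rfl

theorem mem_lcsTerm_iff_of_injective_lcsQuotientMap {f : G →* H} {c : ℕ}
    (hf : Function.Injective (lcsQuotientMap f c)) {g : G} :
    f g ∈ lcsTerm H c ↔ g ∈ lcsTerm G c := by
  rw [← QuotientGroup.eq_one_iff, ← QuotientGroup.eq_one_iff (N := lcsTerm G c)]
  exact map_eq_one_iff (lcsQuotientMap f c) hf (x := (g : G ⧸ lcsTerm G c))

/-- Preimages in `G` of the `H_c`-coordinates of a point of the pro-nilpotent completion of `H`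
are compatible with each other. -/
theorem mk_eq_mk_of_lcs_coordinates {f : G →* H}
    (hf : ∀ c, 1 ≤ c → Function.Injective (lcsQuotientMap f c)) (y : ProNilpotentCompletion H)
    {c d : ℕ} (hc : 1 ≤ c) (hd : 1 ≤ d) {g g' : G}
    (hg : (f g : H ⧸ lcsTerm H c) = y.1 (.lcs H c)) (hg' : (f g' : H ⧸ lcsTerm H d) = y.1 (.lcs H d))
    {K : Subgroup G} (hcK : lcsTerm G c ≤ K) (hdK : lcsTerm G d ≤ K) :
    (g : G ⧸ K) = g' := by
  wlog hcd : c ≤ d generalizing c d g g'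
  · exact (this hd hc hg' hg hdK hcK (le_of_not_ge hcd)).symm
  have h : (f g' : H ⧸ lcsTerm H c) = y.1 (.lcs H c) := by
    rw [← y.2 (.lcs H d) (.lcs H c) (lcsTerm_antitone H hcd), ← hg']
    rfl
  rw [← hg] at h
  refine QuotientGroup.eq.2 (hcK ?_)
  rw [← mem_lcsTerm_iff_of_injective_lcsQuotientMap (hf c hc), map_mul, map_inv]
  exact QuotientGroup.eq.1 h.symm

/-- The quotients by the terms of the lower central series are cofinal among all nilpotent
quotients, so they determine the pro-nilpotent completion. -/
theorem bijective_proNilpotentMap {f : G →* H}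
    (hf : ∀ c, 1 ≤ c → Function.Bijective (lcsQuotientMap f c)) :
    Function.Bijective (proNilpotentMap f) := by
  constructor
  · refine (injective_iff_map_eq_one _).2 fun x hx => Subtype.ext (funext fun K => ?_)
    obtain ⟨c, hc, hcK⟩ := K.exists_lcsTerm_le
    obtain ⟨g, hg⟩ := QuotientGroup.mk_surjective (x.1 ((NilpotentQuotientKernel.lcs H c).comap f))
    have h1 := congrFun (congrArg Subtype.val hx) (.lcs H c)
    rw [proNilpotentMap_apply, ← hg] at h1
    have hle : ((NilpotentQuotientKernel.lcs H c).comap f).toSubgroup ≤ K.toSubgroup := fun g hg =>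
      hcK ((mem_lcsTerm_iff_of_injective_lcsQuotientMap (hf c hc).1).1 hg)
    have hmem : g ∈ K.toSubgroup := hle ((QuotientGroup.eq_one_iff (f g)).1 h1)
    rw [← x.2 _ K hle, ← hg]
    exact (QuotientGroup.eq_one_iff g).2 hmem
  · intro y
    have hinj c hc := (hf c hc).1
    have hlift (c : ℕ) (hc : 1 ≤ c) : ∃ g : G, (f g : H ⧸ lcsTerm H c) = y.1 (.lcs H c) := by
      obtain ⟨z, hz⟩ := (hf c hc).2 (y.1 (.lcs H c))
      obtain ⟨g, rfl⟩ := QuotientGroup.mk_surjective z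
      exact ⟨g, hz⟩
    choose c hc hcK using NilpotentQuotientKernel.exists_lcsTerm_le (G := G)
    choose g hg using fun K => hlift (c K) (hc K)
    refine ⟨⟨fun K => (g K : G ⧸ K.toSubgroup), fun K L h => ?_⟩,
      Subtype.ext (funext fun K => ?_)⟩
    · exact mk_eq_mk_of_lcs_coordinates hinj y (hc K) (hc L) (hg K) (hg L)
        ((hcK K).trans h) (hcK L)
    · rw [proNilpotentMap_apply]
      obtain ⟨d, hd, hdK⟩ := K.exists_lcsTerm_le
      obtain ⟨g', hg'⟩ := hlift d hd
      have h := mk_eq_mk_of_lcs_coordinates hinj y (hc _) hd (hg (K.comap f)) hg' (hcK _)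
        ((lcsTerm_le_comap f d).trans (Subgroup.comap_mono hdK))
      rw [← y.2 (.lcs H d) K hdK, ← hg']
      exact congrArg (QuotientGroup.map (K.comap f).toSubgroup K.toSubgroup f le_rfl) h

theorem IsResiduallyNilpotent.of_injective {f : G →* H} (hf : Function.Injective f)
    (hH : IsResiduallyNilpotent H) : IsResiduallyNilpotent G := by
  intro g hg
  obtain ⟨P, _, φ, hP, hφ⟩ := hH (f g) ((map_ne_one_iff f hf).2 hg)
  obtain ⟨c, -, hc⟩ := exists_lcsTerm_le_ker (φ.comp f)
  exact ⟨G ⧸ lcsTerm G c, inferInstance, QuotientGroup.mk' _,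
    isNilpotent_quotient_of_lcsTerm_le le_rfl,
    fun h => hφ (hc ((QuotientGroup.eq_one_iff g).1 h))⟩

end ProNilpotent

/-! ### Extensions by superperfect groups without finite quotients -/

theorem proposition3p1 {N Γ Q : Type*} [Group N] [Group Γ] [Group Q]
    (u : N →* Γ) (p : Γ →* Q)
    (hu : Function.Injective u) (hexact : u.range = p.ker) (hp : Function.Surjective p)
    (hN : Group.FG N)
    (hfin : Group.FG Γ ∨ Group.IsPerfect Q)
    (hQ : HasNoNontrivialFiniteQuotient Q)
    (hH2 : Subsingleton (integralH2 Q)) :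
    (∀ c : ℕ, 1 ≤ c → Function.Bijective (lcsQuotientMap u c)) ∧
    Function.Bijective (proNilpotentMap u) ∧
    (IsResiduallyNilpotent Γ → SameNilpotentGenus N Γ) := by
  have hperf : Group.IsPerfect Q := hfin.elim
    (fun _ => have := Group.fg_of_surjective hp; hQ.isPerfect) id
  have hfg : Group.FG p.ker := hexact ▸ Group.fg_of_surjective u.rangeRestrict_surjective
  have hker := p.ker.commutator_top_le_commutator_self (hQ.eq_top_of_ker_le p hp)
  have hbij (c : ℕ) (hc : 1 ≤ c) : Function.Bijective (lcsQuotientMap u c) := by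
    constructor
    · refine (injective_iff_map_eq_one _).2 fun x hx => ?_
      obtain ⟨n, rfl⟩ := QuotientGroup.mk_surjective x
      have hmem : u n ∈ lcsTerm Γ c := (QuotientGroup.eq_one_iff (u n)).1 hx
      have hle := Subgroup.ker_inf_lowerCentralSeries_le p hp hperf hH2 hker (c - 1)
        ⟨hexact ▸ ⟨n, rfl⟩, hmem⟩
      rw [← hexact, MonoidHom.range_eq_map, ← Subgroup.map_lowerCentralSeries] at hle
      exact (QuotientGroup.eq_one_iff n).2 ((Subgroup.mem_map_iff_mem hu).1 hle)
    · intro x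
      obtain ⟨γ, rfl⟩ := QuotientGroup.mk_surjective x
      have hγ : γ ∈ p.ker ⊔ lcsTerm Γ c :=
        Subgroup.sup_lowerCentralSeries_eq_top p hp hperf (c - 1) ▸ Subgroup.mem_top γ
      rw [← hexact] at hγ
      obtain ⟨_, ⟨n, rfl⟩, t, ht, rfl⟩ := Subgroup.mem_sup_of_normal_right.1 hγ
      refine ⟨(n : N ⧸ lcsTerm N c), QuotientGroup.eq.2 ?_⟩
      simpa using ht
  exact ⟨hbij, bijective_proNilpotentMap hbij, fun hΓ =>
    ⟨hΓ.of_injective hu, hΓ, fun c hc => ⟨MulEquiv.ofBijective _ (hbij c hc)⟩⟩⟩
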